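/- Let $K$ be a field of characteristic zero and let $A$ be an associative unital $K$-algebra with a complete decreasing filtration $A=A^0\supseteq A^1\supseteq A^2\supseteq\cdots$ by $K$-submodules such that $A^mA^n\subseteq A^{m+n}$ and the canonical map $A\to\varprojlim A/A^n$ is bijective. Let $R:A\to A$ be a $K$-linear map with $R(A^n)\subseteq A^n$ for all $n$ that is Rota--Baxter of weight zero, i.e. $R(u)R(v)=R(R(u)v)+R(uR(v))$ for all $u,v\in A$. All limits and infinite sums are taken in the topology defined by the filtration; $\exp(z)=\sum_{n\ge0}z^n/n!$, $(\mathrm{ad}\,z)(u)=zu-uz$, and $$\frac{\mathrm{ad}\,z}{e^{\mathrm{ad}\,z}-1}(a):=\sum_{n\ge0}\frac{B_n}{n!}(\mathrm{ad}\,z)^n(a),$$ where $B_n$ are the Bernoulli numbers with $B_1=-\tfrac12$. For $a\in A^1$ define the weight-zero CBHD (Campbell--Baker--Hausdorff--Dynkin) recursion by $$\chi_{(0)}(a)=a,\qquad \chi_{(n+1)}(a)=\frac{\mathrm{ad}\,R(\chi_{(n)}(a))}{e^{\mathrm{ad}\,R(\chi_{(n)}(a))}-1}(a),\qquad \chi^0(a)=\lim_{n\to\infty}\chi_{(n)}(a).$$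 Then all these series and the limit converge, all $\chi_{(n)}(a)$ lie in $A^1$, and $\chi^0(a)\in A^1$ satisfies $$\chi^0(a)=\frac{\mathrm{ad}\,R(\chi^0(a))}{e^{\mathrm{ad}\,R(\chi^0(a))}-1}(a),$$ and is the only element of $A^1$ satisfying this equation. Moreover, the exponential series below converge, and: 1. the equation $x=1+R(ax)$ has in $A$ the unique solution $x=\exp\bigl(R(\chi^0(a))\bigr)$; 2. the equation $y=1-R(ya)$ has in $A$ the unique solution $y=\exp\bigl(R(-\chi^0(a))\bigr)$. -/

import Mathlib

/-- `F` is a complete decreasing algebra filtration `A = F 0 ⊇ F 1 ⊇ …` with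
`F m * F n ⊆ F (m + n)`. The last two fields say that the canonical map from `A` to the inverse
limit of the quotients `A ⧸ F n` is injective and surjective. -/
structure IsCompleteFiltration {K A : Type*} [Field K] [Ring A] [Algebra K A]
    (F : ℕ → Submodule K A) : Prop where
  zero_eq_top : F 0 = ⊤
  antitone : Antitone F
  mul_mem : ∀ {m n : ℕ} {x y : A}, x ∈ F m → y ∈ F n → x * y ∈ F (m + n)
  hausdorff : ∀ x : A, (∀ n, x ∈ F n) → x = 0
  complete : ∀ u : ℕ → A, (∀ m n, m ≤ n → u n - u m ∈ F m) → ∃ L : A, ∀ n, u n - L ∈ F n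

/-- `R` is a Rota–Baxter map of weight `θ`. -/
def IsRotaBaxter {K A : Type*} [Field K] [Ring A] [Algebra K A] (θ : K) (R : A →ₗ[K] A) : Prop :=
  ∀ a b : A, R a * R b = R (R a * b) + R (a * R b) - θ • R (a * b)

/-- Convergence of a sequence in the topology whose neighbourhoods of zero are the `F N`. -/
def FiltTendsto {K A : Type*} [Field K] [Ring A] [Algebra K A] (F : ℕ → Submodule K A)
    (u : ℕ → A) (L : A) : Prop :=
  ∀ N : ℕ, ∃ n₀ : ℕ, ∀ n, n₀ ≤ n → u n - L ∈ F N

open Classical in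
/-- The limit of a sequence in the filtration topology (`0` if the sequence diverges). -/
noncomputable def filtLim {K A : Type*} [Field K] [Ring A] [Algebra K A] (F : ℕ → Submodule K A)
    (u : ℕ → A) : A :=
  if h : ∃ L, FiltTendsto F u L then h.choose else 0

/-- The series `∑ u n` converges to `s` in the filtration topology. -/
def FiltHasSum {K A : Type*} [Field K] [Ring A] [Algebra K A] (F : ℕ → Submodule K A)
    (u : ℕ → A) (s : A) : Prop :=
  FiltTendsto F (fun N => ∑ n ∈ Finset.range N, u n) s

/-- The sum of a series in the filtration topology (`0` if the series diverges). -/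
noncomputable def filtSum {K A : Type*} [Field K] [Ring A] [Algebra K A] (F : ℕ → Submodule K A)
    (u : ℕ → A) : A :=
  filtLim F (fun N => ∑ n ∈ Finset.range N, u n)

/-- The `n`-th term `zⁿ / n!` of the exponential series. -/
noncomputable def expTerm (K : Type*) {A : Type*} [Field K] [Ring A] [Algebra K A]
    (z : A) (n : ℕ) : A :=
  ((n.factorial : K)⁻¹) • z ^ n

/-- The exponential `exp z = ∑ zⁿ / n!`. -/
noncomputable def filtExp {K A : Type*} [Field K] [Ring A] [Algebra K A] (F : ℕ → Submodule K A)
    (z : A) : A :=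
  filtSum F (expTerm K z)

/-- The adjoint map `ad z : u ↦ [z, u] = z * u - u * z`. -/
def commAd (K : Type*) {A : Type*} [Field K] [Ring A] [Algebra K A] (z : A) : A →ₗ[K] A :=
  LinearMap.mulLeft K z - LinearMap.mulRight K z

/-- The `n`-th term `(Bₙ / n!) (ad z)ⁿ (a)`. Mathlib's `bernoulli` has `B₁ = -1/2`, so that
`∑ (Bₙ / n!) Xⁿ = X / (exp X - 1)`. -/
noncomputable def adTerm (K : Type*) {A : Type*} [Field K] [Ring A] [Algebra K A]
    (z a : A) (n : ℕ) : A :=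
  ((bernoulli n : K) / (n.factorial : K)) • ((commAd K z) ^ n) a

/-- `(ad z / (exp (ad z) - 1)) (a)`. -/
noncomputable def adOverExpSubOne {K A : Type*} [Field K] [Ring A] [Algebra K A]
    (F : ℕ → Submodule K A) (z a : A) : A :=
  filtSum F (adTerm K z a)

/-- The iterates `χ₍₀₎ = a`, `χ₍ₙ₊₁₎ = (ad R(χ₍ₙ₎) / (exp (ad R(χ₍ₙ₎)) - 1)) (a)` of the
weight-zero CBHD recursion. -/
noncomputable def chiZeroIter {K A : Type*} [Field K] [Ring A] [Algebra K A]
    (F : ℕ → Submodule K A) (R : A →ₗ[K] A) (a : A) : ℕ → A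
  | 0 => a
  | n + 1 => adOverExpSubOne F (R (chiZeroIter F R a n)) a

/-- The weight-zero CBHD recursion `χ⁰(a)`, the limit of its iterates. -/
noncomputable def chiZero {K A : Type*} [Field K] [Ring A] [Algebra K A]
    (F : ℕ → Submodule K A) (R : A →ₗ[K] A) (a : A) : A :=
  filtLim F (chiZeroIter F R a)

/-! Put c = χ⁰(a) and z = R(c). Inverting the Bernoulli series gives a = ((e^{ad z} - 1)/ad z)(c).
Right multiplication by z commutes with ad z, and adding it to ad z gives left multiplication by z;
hence a e^z = ∑ₙ (1/(n+1)!) ∑ᵢ zⁱ c zⁿ⁻ⁱ (`hasSum_exp_apply`). The weight-zero identity makes R send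
the inner sum to zⁿ⁺¹ (`IsRotaBaxter.apply_sum_pow`), so R(a e^z) = e^z - 1. Left multiplication by
-z gives the second equation in the same way.

The element c exists and is unique because z ↦ (ad z/(e^{ad z} - 1))(a) gains one degree on
differences when a ∈ F 1 (`adOverExpSubOne_sub_mem`). The linear equations have unique solutions
because u ↦ R(au) and u ↦ R(ua) raise degree by one. -/

open Finset.HasAntidiagonal (antidiagonal mem_antidiagonal)

/-! ### Convergence in a complete filtration -/

namespace IsCompleteFiltration

variable {K A : Type*} [Field K] [Ring A] [Algebra K A] {F : ℕ → Submodule K A}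

theorem mem_zero (hF : IsCompleteFiltration F) (x : A) : x ∈ F 0 := by
  rw [hF.zero_eq_top]; trivial

theorem tendsto_unique (hF : IsCompleteFiltration F) {u : ℕ → A} {L L' : A}
    (h : FiltTendsto F u L) (h' : FiltTendsto F u L') : L = L' := by
  refine sub_eq_zero.mp (hF.hausdorff _ fun N => ?_)
  obtain ⟨n₁, h₁⟩ := h N
  obtain ⟨n₂, h₂⟩ := h' N
  have := (F N).sub_mem (h₂ _ (le_max_right n₁ n₂)) (h₁ _ (le_max_left n₁ n₂))
  rwa [sub_sub_sub_cancel_left] at this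

theorem filtLim_eq (hF : IsCompleteFiltration F) {u : ℕ → A} {L : A}
    (h : FiltTendsto F u L) : filtLim F u = L := by
  have hex : ∃ L, FiltTendsto F u L := ⟨L, h⟩
  rw [filtLim, dif_pos hex]
  exact hF.tendsto_unique hex.choose_spec h

theorem filtSum_eq (hF : IsCompleteFiltration F) {u : ℕ → A} {s : A}
    (h : FiltHasSum F u s) : filtSum F u = s :=
  hF.filtLim_eq h

theorem sum_range_sub_mem (hF : IsCompleteFiltration F) {u : ℕ → A} (hu : ∀ n, u n ∈ F n)
    {m n : ℕ} (h : m ≤ n) :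
    ∑ i ∈ Finset.range n, u i - ∑ i ∈ Finset.range m, u i ∈ F m := by
  rw [← Finset.sum_Ico_eq_sub _ h]
  exact Submodule.sum_mem _ fun i hi => hF.antitone (Finset.mem_Ico.mp hi).1 (hu i)

/-- The terms from index N on lie in `F N`, so the N-th partial sum already determines the limit
modulo `F N`. -/
theorem hasSum_iff (hF : IsCompleteFiltration F) {u : ℕ → A} (hu : ∀ n, u n ∈ F n) {s : A} :
    FiltHasSum F u s ↔ ∀ N, ∑ n ∈ Finset.range N, u n - s ∈ F N := by
  refine ⟨fun h N => ?_, fun h N => ⟨N, fun n hn => hF.antitone hn (h n)⟩⟩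
  obtain ⟨n₀, h₀⟩ := h N
  have := (F N).sub_mem (h₀ _ (le_max_right N n₀))
    (hF.sum_range_sub_mem hu (le_max_left N n₀))
  rwa [sub_sub_sub_cancel_left] at this

theorem hasSum_filtSum (hF : IsCompleteFiltration F) {u : ℕ → A} (hu : ∀ n, u n ∈ F n) :
    FiltHasSum F u (filtSum F u) := by
  obtain ⟨s, hs⟩ := hF.complete _ fun m n h => hF.sum_range_sub_mem hu h
  have h := (hF.hasSum_iff hu).mpr hs
  rwa [hF.filtSum_eq h]

theorem hasSum_mem {u : ℕ → A} {s : A} {m : ℕ} (hu : ∀ n, u n ∈ F m)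
    (h : FiltHasSum F u s) : s ∈ F m := by
  obtain ⟨n₀, h₀⟩ := h m
  have := (F m).sub_mem (Submodule.sum_mem _ (t := Finset.range n₀) fun i _ => hu i) (h₀ n₀ le_rfl)
  rwa [sub_sub_cancel] at this

theorem hasSum_sub {u v : ℕ → A} {s t : A} (hu : FiltHasSum F u s) (hv : FiltHasSum F v t) :
    FiltHasSum F (fun n => u n - v n) (s - t) := by
  intro N
  obtain ⟨n₁, h₁⟩ := hu N
  obtain ⟨n₂, h₂⟩ := hv N
  refine ⟨max n₁ n₂, fun n hn => ?_⟩
  have := (F N).sub_mem (h₁ n (le_of_max_le_left hn)) (h₂ n (le_of_max_le_right hn))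
  rwa [sub_sub_sub_comm, ← Finset.sum_sub_distrib] at this

theorem hasSum_map {u : ℕ → A} {s : A} (hu : FiltHasSum F u s) (T : A →ₗ[K] A)
    (hT : ∀ n, ∀ x ∈ F n, T x ∈ F n) : FiltHasSum F (fun n => T (u n)) (T s) := by
  intro N
  obtain ⟨n₀, h₀⟩ := hu N
  refine ⟨n₀, fun n hn => ?_⟩
  have := hT N _ (h₀ n hn)
  rwa [map_sub, map_sum] at this

theorem hasSum_neg {u : ℕ → A} {s : A} (hu : FiltHasSum F u s) :
    FiltHasSum F (fun n => -u n) (-s) :=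
  hasSum_map hu (-LinearMap.id) fun _ _ hx => Submodule.neg_mem _ hx

theorem hasSum_of_hasSum_succ {u : ℕ → A} {s : A}
    (h : FiltHasSum F (fun n => u (n + 1)) s) : FiltHasSum F u (u 0 + s) := by
  intro N
  obtain ⟨n₀, h₀⟩ := h N
  refine ⟨n₀ + 1, fun n hn => ?_⟩
  obtain ⟨k, rfl⟩ : ∃ k, n = k + 1 := ⟨n - 1, by omega⟩
  beta_reduce
  rw [Finset.sum_range_succ', add_comm, add_sub_add_left_eq_sub]
  exact h₀ k (by omega)

/-- Cauchy product of two series of operators of degrees `0, 1, 2, …`. -/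
theorem hasSum_antidiagonal_iff (hF : IsCompleteFiltration F) {f g : ℕ → Module.End K A}
    (hf : ∀ n m, ∀ x ∈ F m, f n x ∈ F (n + m)) (hg : ∀ n m, ∀ x ∈ F m, g n x ∈ F (n + m))
    {a b s : A} (hb : FiltHasSum F (fun n => g n a) b) :
    FiltHasSum F (fun n => ∑ p ∈ antidiagonal n, f p.1 (g p.2 a)) s ↔
      FiltHasSum F (fun n => f n b) s := by
  have hg0 : ∀ n, g n a ∈ F n := fun n => hg n 0 a (hF.mem_zero a)
  have hfg : ∀ i j, f i (g j a) ∈ F (i + j) := fun i j => hf i j _ (hg0 j)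
  have hb' := (hF.hasSum_iff hg0).mp hb
  rw [hF.hasSum_iff (fun n => Submodule.sum_mem _ fun p hp => by
      rw [← mem_antidiagonal.mp hp]; exact hfg _ _),
    hF.hasSum_iff (fun n => hf n 0 b (hF.mem_zero b))]
  refine forall_congr' fun N => ?_
  -- Summing along rows, the difference is the sum over i < N of fᵢ applied to an error in `F (N -
  -- i)`; fᵢ raises this to `F N`.
  have key : ∑ n ∈ Finset.range N, ∑ p ∈ antidiagonal n, f p.1 (g p.2 a) -
      ∑ n ∈ Finset.range N, f n b ∈ F N := by
    simp only [Finset.Nat.sum_antidiagonal_eq_sum_range_succ_mk]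
    rw [Finset.sum_range_diag_flip N fun i j => f i (g j a), ← Finset.sum_sub_distrib]
    refine Submodule.sum_mem _ fun i hi => ?_
    have := hf i _ _ (hb' (N - i))
    rwa [map_sub, map_sum, Nat.add_sub_cancel' (Finset.mem_range.mp hi).le] at this
  constructor
  · intro h
    have := (F N).sub_mem h key
    rwa [sub_sub_sub_cancel_left, ← neg_sub, Submodule.neg_mem_iff, ← Submodule.neg_mem_iff,
      neg_sub] at this
  · intro h
    have := (F N).add_mem key h
    rwa [sub_add_sub_cancel] at this

end IsCompleteFiltration

/-! ### The algebraic identities -/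

/-- Both sides represent ((d + x)ⁿ⁺¹ - xⁿ⁺¹)/d. Since d need not be cancellable, the proof is by
induction. -/
theorem Commute.sum_add_pow_mul_pow {S : Type*} [Ring S] {x d : S} (h : Commute d x) (n : ℕ) :
    ∑ i ∈ Finset.range (n + 1), (d + x) ^ i * x ^ (n - i) =
      ∑ j ∈ Finset.range (n + 1), ((n + 1).choose (j + 1)) • (d ^ j * x ^ (n - j)) := by
  induction n with
  | zero => simp
  | succ n ih =>
    have hl : ∑ i ∈ Finset.range (n + 1), (d + x) ^ i * x ^ (n + 1 - i) =
        (∑ i ∈ Finset.range (n + 1), (d + x) ^ i * x ^ (n - i)) * x := by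
      rw [Finset.sum_mul]
      refine Finset.sum_congr rfl fun i hi => ?_
      rw [Nat.succ_sub (Nat.lt_succ_iff.mp (Finset.mem_range.mp hi)), pow_succ, mul_assoc]
    have hr : ∑ j ∈ Finset.range (n + 1), ((n + 1).choose (j + 1)) • (d ^ j * x ^ (n + 1 - j)) =
        (∑ j ∈ Finset.range (n + 1), ((n + 1).choose (j + 1)) • (d ^ j * x ^ (n - j))) * x := by
      rw [Finset.sum_mul]
      refine Finset.sum_congr rfl fun i hi => ?_
      rw [Nat.succ_sub (Nat.lt_succ_iff.mp (Finset.mem_range.mp hi)), pow_succ, smul_mul_assoc,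
        mul_assoc]
    -- Pascal's rule: the first parts add up to (d + x)ⁿ⁺¹, the new top term on the left; the second
    -- parts are the previous case times x.
    have hs : ∀ j, ((n + 2).choose (j + 1)) • (d ^ j * x ^ (n + 1 - j)) =
        d ^ j * x ^ (n + 1 - j) * ((n + 1).choose j : S) +
          ((n + 1).choose (j + 1)) • (d ^ j * x ^ (n + 1 - j)) := fun j => by
      rw [Nat.choose_succ_succ, add_smul, nsmul_eq_mul' _ ((n + 1).choose j)]
    rw [Finset.sum_congr rfl fun j _ => hs j, Finset.sum_add_distrib, ← h.add_pow,
      Finset.sum_range_succ, hl, ih, ← hr, Finset.sum_range_succ _ (n + 1)]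
    rw [Nat.choose_succ_self (n + 1), zero_smul, add_zero, Nat.sub_self, pow_zero, mul_one,
      add_comm]

/-- `(e^{d + x} - e^x) / d = ((e^d - 1) / d) e^x` in degree `n`. -/
theorem Commute.sum_antidiagonal_factorial {K S : Type*} [Field K] [CharZero K] [Ring S]
    [Algebra K S] {x d : S} (h : Commute d x) (n : ℕ) :
    ∑ p ∈ antidiagonal n, ((p.1.factorial : K)⁻¹ • x ^ p.1) *
        (((p.2 + 1).factorial : K)⁻¹ • d ^ p.2) =
      ((n + 1).factorial : K)⁻¹ • ∑ i ∈ Finset.range (n + 1), (d + x) ^ i * x ^ (n - i) := by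
  rw [h.sum_add_pow_mul_pow, ← Finset.Nat.sum_antidiagonal_swap, Finset.smul_sum,
    Finset.Nat.sum_antidiagonal_eq_sum_range_succ_mk]
  refine Finset.sum_congr rfl fun j hj => ?_
  have hj' : j + 1 ≤ n + 1 := Finset.mem_range.mp hj
  simp only [Prod.swap]
  rw [smul_mul_smul_comm, ((h.pow_pow j (n - j)).eq).symm, ← Nat.cast_smul_eq_nsmul K, smul_smul,
    Nat.cast_choose K hj', Nat.add_sub_add_right]
  congr 1
  have := fun k : ℕ => (Nat.cast_ne_zero (R := K)).mpr k.factorial_ne_zero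
  field_simp [this]

/-- Coefficientwise, ((e^X - 1)/X) · (X/(e^X - 1)) = 1. Over ℚ this is `bernoulli_spec'` divided by
n!; it is then cast to K. -/
theorem sum_antidiagonal_bernoulli {K : Type*} [Field K] [CharZero K] (n : ℕ) :
    ∑ p ∈ antidiagonal n, ((p.1 + 1).factorial : K)⁻¹ *
      ((bernoulli p.2 : K) / (p.2.factorial : K)) = if n = 0 then 1 else 0 := by
  have h : ∑ p ∈ antidiagonal n, ((p.1 + 1).factorial : ℚ)⁻¹ *
      (bernoulli p.2 / (p.2.factorial : ℚ)) = if n = 0 then 1 else 0 := by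
    have hn : (n.factorial : ℚ) ≠ 0 := Nat.cast_ne_zero.mpr n.factorial_ne_zero
    refine mul_left_cancel₀ hn (Eq.trans ?_ ((bernoulli_spec' n).trans ?_))
    · rw [Finset.mul_sum, ← Finset.Nat.sum_antidiagonal_swap]
      refine Finset.sum_congr rfl fun p hp => ?_
      have h₁ : (p.1.factorial : ℚ) ≠ 0 := Nat.cast_ne_zero.mpr p.1.factorial_ne_zero
      have h₂ : (p.2.factorial : ℚ) ≠ 0 := Nat.cast_ne_zero.mpr p.2.factorial_ne_zero
      have h₃ : (p.2 + 1 : ℚ) ≠ 0 := Nat.cast_add_one_ne_zero p.2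
      rw [← mem_antidiagonal.mp hp, add_comm p.1, Nat.cast_add_choose]
      simp only [Prod.fst_swap, Prod.snd_swap, Nat.factorial_succ, Nat.cast_mul, Nat.cast_succ]
      field_simp
    · split_ifs with h0 <;> simp [h0]
  have := congrArg (fun q : ℚ => (q : K)) h
  split_ifs at this ⊢ <;> simpa using this

/-! ### The adjoint map and the Bernoulli series -/

section Adjoint

variable {K A : Type*} [Field K] [Ring A] [Algebra K A] {F : ℕ → Submodule K A}

theorem commAd_apply (z u : A) : commAd K z u = z * u - u * z := by
  simp [commAd]

theorem pow_apply_mem {T : Module.End K A} (hT : ∀ m, ∀ x ∈ F m, T x ∈ F (m + 1)) (n m : ℕ)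
    {x : A} (hx : x ∈ F m) : (T ^ n) x ∈ F (n + m) := by
  induction n with
  | zero => simpa using hx
  | succ n ih =>
    rw [pow_succ', Module.End.mul_apply, Nat.add_right_comm]
    exact hT _ _ ih

theorem mulLeft_mem (hF : IsCompleteFiltration F) {z : A} {n : ℕ} (hz : z ∈ F n) (m : ℕ) (x : A)
    (hx : x ∈ F m) : LinearMap.mulLeft K z x ∈ F (m + n) := by
  rw [add_comm]; exact hF.mul_mem hz hx

theorem mulRight_mem (hF : IsCompleteFiltration F) {z : A} {n : ℕ} (hz : z ∈ F n) (m : ℕ) (x : A)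
    (hx : x ∈ F m) : LinearMap.mulRight K z x ∈ F (m + n) :=
  hF.mul_mem hx hz

theorem commAd_mem (hF : IsCompleteFiltration F) {z : A} {n : ℕ} (hz : z ∈ F n) (m : ℕ) (x : A)
    (hx : x ∈ F m) : commAd K z x ∈ F (m + n) :=
  (F _).sub_mem (mulLeft_mem hF hz m x hx) (mulRight_mem hF hz m x hx)

theorem adTerm_mem (hF : IsCompleteFiltration F) {z a : A} (hz : z ∈ F 1) {m : ℕ} (ha : a ∈ F m)
    (n : ℕ) : adTerm K z a n ∈ F (n + m) :=
  (F _).smul_mem _ (pow_apply_mem (commAd_mem hF hz) n m ha)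

theorem hasSum_adTerm (hF : IsCompleteFiltration F) {z a : A} (hz : z ∈ F 1) :
    FiltHasSum F (adTerm K z a) (adOverExpSubOne F z a) :=
  hF.hasSum_filtSum fun n => adTerm_mem hF hz (hF.mem_zero a) n

theorem adOverExpSubOne_mem (hF : IsCompleteFiltration F) {z a : A} (hz : z ∈ F 1) {m : ℕ}
    (ha : a ∈ F m) : adOverExpSubOne F z a ∈ F m :=
  IsCompleteFiltration.hasSum_mem
    (fun n => hF.antitone (Nat.le_add_left m n) (adTerm_mem hF hz ha n)) (hasSum_adTerm hF hz)

theorem commAd_pow_sub_mem (hF : IsCompleteFiltration F) {z z' a : A} (hz : z ∈ F 1)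
    (hz' : z' ∈ F 1) (ha : a ∈ F 1) {n : ℕ} (h : z - z' ∈ F n) (k : ℕ) :
    (commAd K z ^ k) a - (commAd K z' ^ k) a ∈ F (n + 1) := by
  induction k with
  | zero => simp
  | succ k ih =>
    -- The difference of the (k+1)-st powers splits as ad z (ad zᵏ - ad z'ᵏ) + ad(z - z') ad z'ᵏ. In
    -- the second term the extra degree comes from a ∈ F 1.
    have h₁ := commAd_mem hF hz _ _ ih
    have h₂ := commAd_mem hF h _ _ (pow_apply_mem (commAd_mem hF hz') k 1 ha)
    have := (F (n + 1)).add_mem (hF.antitone (by omega) h₁) (hF.antitone (by omega) h₂)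
    convert this using 1
    simp only [pow_succ', Module.End.mul_apply, commAd_apply]
    noncomm_ring

/-- The contraction estimate behind convergence of the iterates, the fixed-point equation and its
uniqueness. -/
theorem adOverExpSubOne_sub_mem (hF : IsCompleteFiltration F) {z z' a : A} (hz : z ∈ F 1)
    (hz' : z' ∈ F 1) (ha : a ∈ F 1) {n : ℕ} (h : z - z' ∈ F n) :
    adOverExpSubOne F z a - adOverExpSubOne F z' a ∈ F (n + 1) := by
  refine IsCompleteFiltration.hasSum_mem (fun k => ?_)
    (IsCompleteFiltration.hasSum_sub (hasSum_adTerm hF hz) (hasSum_adTerm hF hz'))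
  rw [adTerm, adTerm, ← smul_sub]
  exact (F _).smul_mem _ (commAd_pow_sub_mem hF hz hz' ha h k)

theorem hasSum_expTerm (hF : IsCompleteFiltration F) {z : A} (hz : z ∈ F 1) :
    FiltHasSum F (expTerm K z) (filtExp F z) := by
  refine hF.hasSum_filtSum fun n => (F n).smul_mem _ ?_
  have := pow_apply_mem (mulLeft_mem hF hz) n 0 (hF.mem_zero 1)
  simpa using this

/-- `((e^{ad z} - 1) / ad z) (c) = a` if `c = (ad z / (e^{ad z} - 1)) (a)`. -/
theorem hasSum_commAd_of_hasSum_adTerm [CharZero K] (hF : IsCompleteFiltration F) {z a c : A}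
    (hz : z ∈ F 1) (hc : FiltHasSum F (adTerm K z a) c) :
    FiltHasSum F (fun n => (((n + 1).factorial : K)⁻¹ • commAd K z ^ n) c) a := by
  have hp : ∀ (k : ℕ → K) (n m : ℕ), ∀ x ∈ F m, (k n • commAd K z ^ n) x ∈ F (n + m) :=
    fun k n m x hx => (F _).smul_mem _ (pow_apply_mem (commAd_mem hF hz) n m hx)
  refine (hF.hasSum_antidiagonal_iff (hp fun n => ((n + 1).factorial : K)⁻¹)
    (hp fun n => (bernoulli n : K) / (n.factorial : K)) hc).mp ?_
  have : ∀ n, ∑ p ∈ antidiagonal n, (((p.1 + 1).factorial : K)⁻¹ • commAd K z ^ p.1)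
      ((((bernoulli p.2 : K) / (p.2.factorial : K)) • commAd K z ^ p.2) a) =
      if n = 0 then a else 0 := fun n => by
    have h : ∀ p ∈ antidiagonal n, (((p.1 + 1).factorial : K)⁻¹ • commAd K z ^ p.1)
      ((((bernoulli p.2 : K) / (p.2.factorial : K)) • commAd K z ^ p.2) a) =
      (((p.1 + 1).factorial : K)⁻¹ * ((bernoulli p.2 : K) / (p.2.factorial : K))) •
        (commAd K z ^ n) a := fun p hp => by
      rw [← mem_antidiagonal.mp hp, pow_add, ← Module.End.mul_apply, smul_mul_smul_comm]
      rfl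
    rw [Finset.sum_congr rfl h, ← Finset.sum_smul, sum_antidiagonal_bernoulli]
    split_ifs with h0 <;> simp [h0]
  simp only [this]
  refine fun N => ⟨1, fun n hn => ?_⟩
  beta_reduce
  rw [Finset.sum_ite_eq' (Finset.range n), if_pos (Finset.mem_range.mpr hn), sub_self]
  exact (F N).zero_mem

/-- If `c = (ad z / (e^{ad z} - 1)) (a)` and `T` commutes with `ad z`, then
`e^T a = ((e^{ad z + T} - e^T) / ad z) (c)`, where the right-hand side is expanded in powers of
`ad z + T` and `T`. -/
theorem hasSum_exp_apply [CharZero K] (hF : IsCompleteFiltration F) {z a c : A}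
    (hz : z ∈ F 1) (hc : FiltHasSum F (adTerm K z a) c) {T : Module.End K A}
    (hT : ∀ m, ∀ x ∈ F m, T x ∈ F (m + 1)) (hcomm : Commute (commAd K z) T) {s : A}
    (hs : FiltHasSum F (fun n => ((n.factorial : K)⁻¹ • T ^ n) a) s) :
    FiltHasSum F (fun n => ((n + 1).factorial : K)⁻¹ •
      ∑ i ∈ Finset.range (n + 1), ((commAd K z + T) ^ i * T ^ (n - i)) c) s := by
  have hp : ∀ {S : Module.End K A}, (∀ m, ∀ x ∈ F m, S x ∈ F (m + 1)) → ∀ (k : ℕ → K) (n m : ℕ),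
      ∀ x ∈ F m, (k n • S ^ n) x ∈ F (n + m) :=
    fun hS k n m x hx => (F _).smul_mem _ (pow_apply_mem hS n m hx)
  have h := (hF.hasSum_antidiagonal_iff (hp hT fun n => (n.factorial : K)⁻¹)
    (hp (commAd_mem hF hz) fun n => ((n + 1).factorial : K)⁻¹)
    (hasSum_commAd_of_hasSum_adTerm hF hz hc)).mpr hs
  convert h using 2 with n
  have := congrArg (fun S : Module.End K A => S c) (hcomm.sum_antidiagonal_factorial (K := K) n)
  simpa [LinearMap.sum_apply] using this.symm

end Adjoint

/-! ### Rota–Baxter maps of weight zero -/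

section RotaBaxter

variable {K A : Type*} [Field K] [Ring A] [Algebra K A] {F : ℕ → Submodule K A} {R : A →ₗ[K] A}

/-- With S the inner sum, zⁿ⁺¹ z = R(S) R(c) = R(zⁿ⁺¹ c) + R(S z): the first term supplies the new
index i = n + 1, the second all the others. -/
theorem IsRotaBaxter.apply_sum_pow (hR : IsRotaBaxter (0 : K) R) (c : A) (n : ℕ) :
    R (∑ i ∈ Finset.range (n + 1), R c ^ i * c * R c ^ (n - i)) = R c ^ (n + 1) := by
  induction n with
  | zero => simp
  | succ n ih =>
    rw [pow_succ, ← ih, hR, zero_smul, sub_zero, ih, ← map_add, Finset.sum_range_succ,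
      Nat.sub_self, pow_zero, mul_one, add_comm, Finset.sum_mul]
    congr 2
    refine Finset.sum_congr rfl fun i hi => ?_
    rw [Nat.succ_sub (Nat.lt_succ_iff.mp (Finset.mem_range.mp hi)), pow_succ]
    simp only [mul_assoc]

theorem filtExp_eq_one_add [CharZero K] (hF : IsCompleteFiltration F)
    (hR : IsRotaBaxter (0 : K) R) (hRF : ∀ n, ∀ x ∈ F n, R x ∈ F n) {a c : A} (hc1 : c ∈ F 1)
    (hc : FiltHasSum F (adTerm K (R c) a) c) :
    filtExp F (R c) = 1 + R (a * filtExp F (R c)) := by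
  have hz := hRF 1 c hc1
  have hs : FiltHasSum F
      (fun n => ((n.factorial : K)⁻¹ • LinearMap.mulRight K (R c) ^ n) a)
      (a * filtExp F (R c)) := by
    have := IsCompleteFiltration.hasSum_map (hasSum_expTerm hF hz) (LinearMap.mulLeft K a)
      fun n x hx => hF.antitone (by omega) (mulLeft_mem hF (hF.mem_zero a) n x hx)
    simpa [expTerm, LinearMap.pow_mulRight] using this
  have hcomm : Commute (commAd K (R c)) (LinearMap.mulRight K (R c)) :=
    (LinearMap.commute_mulLeft_right _ _).sub_left (Commute.refl _)
  have h := IsCompleteFiltration.hasSum_map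
    (hasSum_exp_apply hF hz hc (mulRight_mem hF hz) hcomm hs) R hRF
  refine hF.filtSum_eq ?_
  have h' := IsCompleteFiltration.hasSum_of_hasSum_succ (F := F) (u := expTerm K (R c))
    (s := R (a * filtExp F (R c))) ?_
  · simpa [expTerm] using h'
  · convert h using 2 with n
    rw [map_smul, expTerm, ← hR.apply_sum_pow]
    simp [commAd, LinearMap.pow_mulRight, LinearMap.pow_mulLeft, mul_assoc]

theorem filtExp_neg_eq_one_sub [CharZero K] (hF : IsCompleteFiltration F)
    (hR : IsRotaBaxter (0 : K) R) (hRF : ∀ n, ∀ x ∈ F n, R x ∈ F n) {a c : A} (hc1 : c ∈ F 1)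
    (hc : FiltHasSum F (adTerm K (R c) a) c) :
    filtExp F (R (-c)) = 1 - R (filtExp F (R (-c)) * a) := by
  have hz := hRF 1 c hc1
  have hz' := hRF 1 _ ((F 1).neg_mem hc1)
  have hs : FiltHasSum F
      (fun n => ((n.factorial : K)⁻¹ • LinearMap.mulLeft K (R (-c)) ^ n) a)
      (filtExp F (R (-c)) * a) := by
    have := IsCompleteFiltration.hasSum_map (hasSum_expTerm hF hz') (LinearMap.mulRight K a)
      fun n x hx => mulRight_mem hF (hF.mem_zero a) n x hx
    simpa [expTerm, LinearMap.pow_mulLeft] using this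
  -- Here T is left multiplication by -R(c), so ad R(c) + T is right multiplication by -R(c).
  have hL : LinearMap.mulLeft K (R (-c)) = -LinearMap.mulLeft K (R c) := by ext; simp
  have hsum : commAd K (R c) + LinearMap.mulLeft K (R (-c)) = LinearMap.mulRight K (R (-c)) := by
    ext; simp [commAd]; abel
  have hcomm : Commute (commAd K (R c)) (LinearMap.mulLeft K (R (-c))) := by
    rw [hL]
    exact ((Commute.refl _).sub_left (LinearMap.commute_mulLeft_right _ _).symm).neg_right
  have h := IsCompleteFiltration.hasSum_neg (IsCompleteFiltration.hasSum_map
    (hasSum_exp_apply hF hz hc (mulLeft_mem hF hz') hcomm hs) R hRF)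
  refine hF.filtSum_eq ?_
  have h' := IsCompleteFiltration.hasSum_of_hasSum_succ (F := F) (u := expTerm K (R (-c)))
    (s := -R (filtExp F (R (-c)) * a)) ?_
  · simpa [expTerm, sub_eq_add_neg] using h'
  · convert h using 2 with n
    -- Left and right powers have exchanged roles, so the sum is reflected; the outer minus sign
    -- turns the middle factor c into -c.
    rw [map_smul, expTerm, ← hR.apply_sum_pow, hsum, ← smul_neg, ← map_neg,
      ← Finset.sum_range_reflect, ← Finset.sum_neg_distrib]
    congr 2
    refine Finset.sum_congr rfl fun i hi => ?_
    have hi' : n - (n - i) = i := Nat.sub_sub_self (Nat.lt_succ_iff.mp (Finset.mem_range.mp hi))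
    simp [LinearMap.pow_mulRight, LinearMap.pow_mulLeft, mul_assoc, hi']

theorem eq_zero_of_eq_apply (hF : IsCompleteFiltration F) {T : A → A}
    (hT : ∀ n, ∀ x ∈ F n, T x ∈ F (n + 1)) {x : A} (hx : x = T x) : x = 0 := by
  refine hF.hausdorff x fun n => ?_
  induction n with
  | zero => exact hF.mem_zero x
  | succ n ih => rw [hx]; exact hT n x ih

theorem eq_one_add_unique (hF : IsCompleteFiltration F) (hRF : ∀ n, ∀ x ∈ F n, R x ∈ F n)
    {a x x' : A} (ha : a ∈ F 1) (hx : x = 1 + R (a * x)) (hx' : x' = 1 + R (a * x')) :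
    x = x' := by
  refine sub_eq_zero.mp (eq_zero_of_eq_apply hF (T := fun u => R (a * u))
    (fun n u hu => hRF _ _ (mulLeft_mem hF ha n u hu)) ?_)
  rw [mul_sub, map_sub]
  nth_rw 1 [hx, hx']
  exact add_sub_add_left_eq_sub _ _ _

theorem eq_one_sub_unique (hF : IsCompleteFiltration F) (hRF : ∀ n, ∀ x ∈ F n, R x ∈ F n)
    {a y y' : A} (ha : a ∈ F 1) (hy : y = 1 - R (y * a)) (hy' : y' = 1 - R (y' * a)) :
    y = y' := by
  refine sub_eq_zero.mp (eq_zero_of_eq_apply hF (T := fun u => -R (u * a))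
    (fun n u hu => (F _).neg_mem (hRF _ _ (mulRight_mem hF ha n u hu))) ?_)
  rw [sub_mul, map_sub]
  nth_rw 1 [hy, hy']
  abel

/-! ### The recursion -/

theorem chiZeroIter_mem (hF : IsCompleteFiltration F) (hRF : ∀ n, ∀ x ∈ F n, R x ∈ F n) {a : A}
    (ha : a ∈ F 1) (n : ℕ) : chiZeroIter F R a n ∈ F 1 := by
  induction n with
  | zero => exact ha
  | succ n ih => exact adOverExpSubOne_mem hF (hRF _ _ ih) ha

theorem chiZeroIter_succ_sub_mem (hF : IsCompleteFiltration F)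
    (hRF : ∀ n, ∀ x ∈ F n, R x ∈ F n) {a : A} (ha : a ∈ F 1) (n : ℕ) :
    chiZeroIter F R a (n + 1) - chiZeroIter F R a n ∈ F (n + 1) := by
  have hm := chiZeroIter_mem hF hRF ha
  induction n with
  | zero => exact (F 1).sub_mem (hm _) (hm _)
  | succ n ih =>
    refine adOverExpSubOne_sub_mem hF (hRF _ _ (hm _)) (hRF _ _ (hm _)) ha ?_
    rw [← map_sub]
    exact hRF _ _ ih

theorem chiZeroIter_sub_chiZero_mem (hF : IsCompleteFiltration F)
    (hRF : ∀ n, ∀ x ∈ F n, R x ∈ F n) {a : A} (ha : a ∈ F 1) (n : ℕ) :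
    chiZeroIter F R a n - chiZero F R a ∈ F n := by
  obtain ⟨L, hL⟩ := hF.complete (chiZeroIter F R a) fun m n hmn => by
    induction n, hmn using Nat.le_induction with
    | base => simp
    | succ n hmn ih =>
      rw [← sub_add_sub_cancel]
      exact (F m).add_mem (hF.antitone (by omega) (chiZeroIter_succ_sub_mem hF hRF ha n)) ih
  have : chiZero F R a = L := hF.filtLim_eq fun N => ⟨N, fun n hn => hF.antitone hn (hL n)⟩
  rw [this]
  exact hL n

theorem chiZero_mem (hF : IsCompleteFiltration F) (hRF : ∀ n, ∀ x ∈ F n, R x ∈ F n) {a : A}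
    (ha : a ∈ F 1) : chiZero F R a ∈ F 1 := by
  have := (F 1).sub_mem (chiZeroIter_mem hF hRF ha 1) (chiZeroIter_sub_chiZero_mem hF hRF ha 1)
  rwa [sub_sub_cancel] at this

theorem chiZero_eq (hF : IsCompleteFiltration F) (hRF : ∀ n, ∀ x ∈ F n, R x ∈ F n) {a : A}
    (ha : a ∈ F 1) : chiZero F R a = adOverExpSubOne F (R (chiZero F R a)) a := by
  -- Both sides are compared with the iterate of index n + 1, modulo `F (n + 1)`.
  refine sub_eq_zero.mp (hF.hausdorff _ fun n => hF.antitone (Nat.le_succ n) ?_)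
  have h₁ := chiZeroIter_sub_chiZero_mem hF hRF ha (n + 1)
  have h₂ : chiZeroIter F R a (n + 1) - adOverExpSubOne F (R (chiZero F R a)) a ∈ F (n + 1) := by
    refine adOverExpSubOne_sub_mem hF (hRF _ _ (chiZeroIter_mem hF hRF ha n))
      (hRF _ _ (chiZero_mem hF hRF ha)) ha ?_
    rw [← map_sub]
    exact hRF _ _ (chiZeroIter_sub_chiZero_mem hF hRF ha n)
  have := (F (n + 1)).sub_mem h₂ h₁
  rwa [sub_sub_sub_cancel_left] at this

theorem adOverExpSubOne_fixed_unique (hF : IsCompleteFiltration F)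
    (hRF : ∀ n, ∀ x ∈ F n, R x ∈ F n) {a c c' : A} (ha : a ∈ F 1) (hc : c ∈ F 1) (hc' : c' ∈ F 1)
    (h : c = adOverExpSubOne F (R c) a) (h' : c' = adOverExpSubOne F (R c') a) : c = c' := by
  refine sub_eq_zero.mp (hF.hausdorff _ fun n => ?_)
  induction n with
  | zero => exact hF.mem_zero _
  | succ n ih =>
    rw [h, h']
    refine adOverExpSubOne_sub_mem hF (hRF _ _ hc) (hRF _ _ hc') ha ?_
    rw [← map_sub]
    exact hRF _ _ ih

end RotaBaxter

theorem mainTheorem4 {K A : Type*} [Field K] [CharZero K] [Ring A] [Algebra K A]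
    (F : ℕ → Submodule K A) (hF : IsCompleteFiltration F)
    (R : A →ₗ[K] A) (hR : IsRotaBaxter (0 : K) R) (hRF : ∀ n, ∀ x ∈ F n, R x ∈ F n)
    (a : A) (ha : a ∈ F 1) :
    -- all iterates are sums of convergent series, they lie in `F 1`, and they converge to `χ⁰(a)`
    ((∀ n, chiZeroIter F R a n ∈ F 1 ∧
        FiltHasSum F (adTerm K (R (chiZeroIter F R a n)) a) (chiZeroIter F R a (n + 1))) ∧
      FiltTendsto F (chiZeroIter F R a) (chiZero F R a)) ∧
    -- `χ⁰(a)` is the unique solution in `F 1` of the weight-zero recursion formula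
    (chiZero F R a ∈ F 1 ∧
      FiltHasSum F (adTerm K (R (chiZero F R a)) a) (chiZero F R a) ∧
      chiZero F R a = adOverExpSubOne F (R (chiZero F R a)) a ∧
      ∀ c ∈ F 1, c = adOverExpSubOne F (R c) a → c = chiZero F R a) ∧
    -- the unique solution of `x = 1 + R (a x)`
    (FiltHasSum F (expTerm K (R (chiZero F R a))) (filtExp F (R (chiZero F R a))) ∧
      ∀ x : A, x = 1 + R (a * x) ↔ x = filtExp F (R (chiZero F R a))) ∧
    -- the unique solution of `y = 1 - R (y a)`
    (FiltHasSum F (expTerm K (R (-chiZero F R a))) (filtExp F (R (-chiZero F R a))) ∧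
      ∀ y : A, y = 1 - R (y * a) ↔ y = filtExp F (R (-chiZero F R a))) := by
  have hmem := chiZero_mem hF hRF ha
  have heq := chiZero_eq hF hRF ha
  have hsum : FiltHasSum F (adTerm K (R (chiZero F R a)) a) (chiZero F R a) := by
    have := hasSum_adTerm hF (a := a) (hRF _ _ hmem)
    rwa [← heq] at this
  have hx := filtExp_eq_one_add hF hR hRF hmem hsum
  have hy := filtExp_neg_eq_one_sub hF hR hRF hmem hsum
  refine ⟨⟨fun n => ⟨chiZeroIter_mem hF hRF ha n,
        hasSum_adTerm hF (hRF _ _ (chiZeroIter_mem hF hRF ha n))⟩,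
      fun N => ⟨N, fun n hn => hF.antitone hn (chiZeroIter_sub_chiZero_mem hF hRF ha n)⟩⟩,
    ⟨hmem, hsum, heq, fun c hc h => adOverExpSubOne_fixed_unique hF hRF ha hc hmem h heq⟩,
    ⟨hasSum_expTerm hF (hRF _ _ hmem), fun x => ⟨fun h => eq_one_add_unique hF hRF ha h hx, ?_⟩⟩,
    ⟨hasSum_expTerm hF (hRF _ _ ((F 1).neg_mem hmem)),
      fun y => ⟨fun h => eq_one_sub_unique hF hRF ha h hy, ?_⟩⟩⟩
  · rintro rfl; exact hx
  · rintro rfl; exact hy
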